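/- **Setting.** Let $\mathcal N$ be a finite ground set with $|\mathcal N|=n\ge 2$, let $f\colon 2^{\mathcal N}\to\mathbb R_{\ge 0}$ be submodular (not necessarily monotone), let $B>0$, let each $u\in\mathcal N$ have a cost $0<c(u)\le B$, and put $c(X)=\sum_{u\in X}c(u)$. Call $X$ feasible if $c(X)\le B$, and let $r$ be the largest cardinality of a feasible set. Write $f(u\mid X)=f(X\cup\{u\})-f(X)$. The function $f$ is accessible through a value oracle. An algorithm proceeds in adaptive rounds: in each round it submits finitely many sets, which may depend only on the answers of earlier rounds and on random bits, and learns their values. Its *adaptive complexity* is its number of rounds and its *query complexity* its total number of queries, both in the worst case over its random choices; algorithms that run in parallel share their rounds, and their queries add up. Fix $\epsilon\in(0,1)$, and let $\mathsf{USM}(X)$, for $X\subseteq\mathcal N$, be a randomized procedure (for $\max\{f(Y):Y\subseteq X\}$) that uses at most $R$ adaptive rounds and at most $Qn$ queries, where $R,Q$ are constants. **Algorithms.** $\mathsf{GetSEQ}(A,I)$: start with the empty sequence $V$. While $I\neq\emptyset$: permute $I$ uniformly at random into $v_1,\dots,v_{|I|}$, append to $V$ the longest prefix $v_1,\dots,v_s$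 for which $A\cup V\cup\{v_1,\dots,v_s\}$ is feasible, and replace $I$ by $\{u\in I\setminus V: A\cup V\cup\{u\}\text{ feasible}\}$. Return $V$. $\mathsf{RandBatch}(\rho,I,M,p,\epsilon)$: start with $A=U=\emptyset$, $count=0$ and $L=\{u\in I: f(u\mid \emptyset)/c(u)\ge\rho,\ \{u\}\text{ feasible}\}$. While $L\ne\emptyset$ and $count<M$: let $(v_1,\dots,v_d)=\mathsf{GetSEQ}(A,L)$; for $0\le i\le d$ put $V_i=\{v_1,\dots,v_i\}$, $G_i=A\cup V_i$, $E_i^+=\{u\in L: f(u\mid G_i)/c(u)\ge\rho,\ G_i\cup\{u\}\text{ feasible}\}$, $E_i^-=\{u\in L: f(u\mid G_i)<0\}$ and $D_i=\{v_j: j\le i,\ f(v_j\mid G_{j-1})<0\}$; let $t_1$ be the least $i\le d$ with $c(E_i^+)\le(1-\epsilon)c(L)$, let $t_2$ be the least $i\le d$ with $\epsilon\sum_{u\in E_i^+}f(u\mid G_i)\le\sum_{u\in E_i^-}|f(u\mid G_i)|+\sum_{v_j\in D_i}|f(v_j\mid G_{j-1})|$, and put $t^*=\min\{t_1,t_2\}$;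 add $V_{t^*}$ to $U$; with probability $p$, add $V_{t^*}$ to $A$ and, if $t_2<t_1$, increase $count$ by $1$; replace $L$ by $\{u\in L\setminus U: f(u\mid A)/c(u)\ge\rho,\ A\cup\{u\}\text{ feasible}\}$. Return $(A,U,L)$. The indices $t_1,t_2$ are found either by evaluating all $i\le d$ in parallel (*exhaustive search*) or by *binary search* over $i$. $\mathsf{Probe}(\rho,\mathcal N_1,\mathcal N_2,\epsilon)$: with $M=\lceil\epsilon^{-2}\rceil$ and $p=1$, let $A_1$ be the first component of $\mathsf{RandBatch}(\rho,\mathcal N_1,M,p,\epsilon)$ and $A_2$ that of $\mathsf{RandBatch}(\rho,\mathcal N_1\setminus A_1,M,p,\epsilon)$. Start with $T=\emptyset$. For $i=1,2$ let $e_i$ maximize $f(A_i\cup\{u\})$ over the $u\in\mathcal N_1$ with $A_i\cup\{u\}$ feasible, and replace $T$ by the best of $T,A_i,A_i\cup\{e_i\}$ (without the last if there is no such $u$). If $\mathcal N_2\cup A_1$ is feasible, replace $T$ by the better of $T$ and $\mathsf{USM}(\mathcal N_2\cup A_1)$. Return $T$. $\mathsf{ParSKP}(\alpha,\epsilon)$,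 for $\alpha>0$: let $\mathcal N_1=\{u: c(u)>\epsilon B/n\}$, $\mathcal N_2=\mathcal N\setminus\mathcal N_1$, let $u^*$ maximize $f(\{u\})$, and let $S$ be the better of $\mathsf{USM}(\mathcal N_2)$ and $\{u^*\}$. Let $Z$ be the set of all numbers $(1-\epsilon)^{-z}$, $z\in\mathbb Z$, in the interval $\left[\frac{\alpha f(\{u^*\})}{B},\frac{n^2\alpha f(\{u^*\})}{\epsilon B}\right]$. In parallel, for each $\rho\in Z$, run $\mathsf{Probe}(\rho,\mathcal N_1,\mathcal N_2,\epsilon)$ independently $\lceil\log_{1-\epsilon}\epsilon\rceil$ times. Return the best of $S$ and all the sets so obtained. **Theorem.** For all $\epsilon\in(0,1)$ and all constants $R,Q$ there is a constant $C>0$, depending only on $\epsilon,R,Q$, such that for all $\mathcal N,f,c,B,\alpha,\mathsf{USM}$ as above $\mathsf{ParSKP}$ always terminates, and 1. with exhaustive search it has adaptive complexity at most $C\log n$ and query complexity at most $C\,n\,r\log^2 n$; 2. with binary search it has, if $r\ge 2$, adaptive complexity at most $C\log n\log r$ and query complexity at most $C\,n\log^2 n\log r$. -/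

import Mathlib

open scoped NNReal ENNReal

noncomputable section

namespace ParSubmod

/-! ### Randomized algorithms with parallel access to a value oracle -/

/-- Randomized algorithms, with output in `α`, that access a set function on `N` through a value
oracle, in adaptive rounds. In one round a list of sets is submitted, and the rest of the algorithm
may depend on the values of these sets only (see `mask`, `rounds` and `queries`). Drawing random
bits costs nothing. `abort` stands for a run that never delivers an output. -/
inductive Alg (N : Type) (α : Type) : Type 1
  | pure (a : α) : Alg N α
  | abort : Alg N α
  | toss {Ω : Type} (μ : PMF Ω) (k : Ω → Alg N α) : Alg N α
  | round (qs : List (Finset N)) (k : (Finset N → ℝ) → Alg N α) : Alg N α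

/-- The oracle answers to the queries `qs`: nothing is revealed about sets outside `qs`. -/
def mask {N : Type} [DecidableEq N] (qs : List (Finset N)) (F : Finset N → ℝ) : Finset N → ℝ :=
  fun S => if S ∈ qs then F S else 0

namespace Alg

variable {N α β : Type}

/-- Sequential composition. -/
def bind : Alg N α → (α → Alg N β) → Alg N β
  | .pure a, g => g a
  | .abort, _ => .abort
  | .toss μ k, g => .toss μ (fun ω => bind (k ω) g)
  | .round qs k, g => .round qs (fun F => bind (k F) g)

instance : Monad (Alg N) where
  pure := Alg.pure
  bind := Alg.bind

/-- One adaptive round with queries `qs`, which returns the answers. -/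
def ask (qs : List (Finset N)) : Alg N (Finset N → ℝ) := .round qs .pure

/-- Auxiliary to `par`: the first algorithm is about to submit `qs` and then to continue, next to
the remainder of the second one, as `k` says. -/
def parRound [DecidableEq N] (qs : List (Finset N))
    (k : (Finset N → ℝ) → Alg N β → Alg N (α × β)) : Alg N β → Alg N (α × β)
  | .pure b => .round qs (fun F => k F (.pure b))
  | .abort => .abort
  | .toss μ k' => .toss μ (fun ω => parRound qs k (k' ω))
  | .round qs' k' => .round (qs ++ qs') (fun F => k (mask qs F) (k' (mask qs' F)))

/-- Parallel composition: two algorithms with independent random bits run in lockstep, the queries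
of their `i`-th rounds being submitted together in one round. Each sees only its own answers. -/
def par [DecidableEq N] : Alg N α → Alg N β → Alg N (α × β)
  | .pure a, y => bind y (fun b => .pure (a, b))
  | .abort, _ => .abort
  | .toss μ k, y => .toss μ (fun ω => par (k ω) y)
  | .round qs k, y => parRound qs (fun F z => par (k F) z) y

/-- Parallel composition of a list of algorithms. -/
def parAll [DecidableEq N] : List (Alg N α) → Alg N (List α)
  | [] => .pure []
  | x :: xs => bind (par x (parAll xs)) (fun p => .pure (p.1 :: p.2))

/-- Adaptive complexity on the oracle `f`: the number of adaptive rounds, in the worst case over the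
random choices (`⊤` if the algorithm may fail to deliver an output). -/
def rounds [DecidableEq N] (f : Finset N → ℝ) : Alg N α → ℕ∞
  | .pure _ => 0
  | .abort => ⊤
  | .toss μ k => ⨆ ω ∈ μ.support, rounds f (k ω)
  | .round qs k => 1 + rounds f (k (mask qs f))

/-- Query complexity on the oracle `f`: the number of oracle queries (repetitions counted), in the
worst case over the random choices (`⊤` if the algorithm may fail to deliver an output). -/
def queries [DecidableEq N] (f : Finset N → ℝ) : Alg N α → ℕ∞
  | .pure _ => 0
  | .abort => ⊤
  | .toss μ k => ⨆ ω ∈ μ.support, queries f (k ω)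
  | .round qs k => (qs.length : ℕ∞) + queries f (k (mask qs f))

/-- A uniformly random ordering of the elements of `I`. -/
def shuffle (I : Finset N) : Alg N (List N) :=
  .toss (PMF.uniformOfFintype (Equiv.Perm (Fin I.toList.length)))
    (fun σ => .pure (List.ofFn (fun i => I.toList.get (σ i))))

/-- A coin that shows `true` with probability `p`. -/
def coin (p : ℝ≥0) (hp : p ≤ 1) : Alg N Bool :=
  .toss (PMF.ofFintype (fun b : Bool => ((if b then p else 1 - p : ℝ≥0) : ℝ≥0∞))
    (by rw [Fintype.sum_bool]; simp only [if_true, Bool.false_eq_true, if_false]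
        rw [← ENNReal.coe_add, add_tsub_cancel_of_le hp, ENNReal.coe_one])) .pure

/-- Binary search for the smallest `i ∈ [lo, hi]` that passes a monotone test, where `hi` is known
to pass it. -/
def binSearch (test : ℕ → Alg N Bool) (lo hi : ℕ) : Alg N ℕ :=
  if lo < hi then
    bind (test ((lo + hi) / 2)) fun b =>
      if b then binSearch test lo ((lo + hi) / 2) else binSearch test ((lo + hi) / 2 + 1) hi
  else .pure lo
termination_by hi - lo

end Alg

/-! ### The knapsack problem -/

variable {N : Type} [DecidableEq N]

/-- Submodularity of a set function. -/
def IsSubmodular (f : Finset N → ℝ) : Prop :=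
  ∀ X Y : Finset N, f (X ∪ Y) + f (X ∩ Y) ≤ f X + f Y

/-- The cost of a set of elements. -/
def cost (c : N → ℝ) (X : Finset N) : ℝ := ∑ u ∈ X, c u

open Classical in
/-- The largest cardinality of a set of cost at most `B`. -/
def maxCard [Fintype N] (c : N → ℝ) (B : ℝ) : ℕ :=
  (Finset.univ.filter (fun X : Finset N => cost c X ≤ B)).sup Finset.card

/-! ### The procedures `GetSEQ` and `RandBatch` -/

open Classical in
/-- The loop of `GetSEQ`. At least one element leaves `I` in each pass, as long as every element of
`I` can be added to `A ∪ V`; so `|I|` passes suffice. -/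
def getSeqLoop (c : N → ℝ) (B : ℝ) (A : Finset N) : ℕ → List N → Finset N → Alg N (List N)
  | 0, V, I => if I = ∅ then pure V else .abort
  | fuel + 1, V, I =>
    if I = ∅ then pure V else do
      let l ← Alg.shuffle I
      let s := Nat.findGreatest
        (fun i => cost c (A ∪ V.toFinset ∪ (l.take i).toFinset) ≤ B) l.length
      let V' := V ++ l.take s
      getSeqLoop c B A fuel V'
        ((I \ V'.toFinset).filter (fun u => cost c (insert u (A ∪ V'.toFinset)) ≤ B))

/-- `GetSEQ(A, I, c)`: a random sequence of elements of `I` that can be added to `A`. -/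
def getSeq (c : N → ℝ) (B : ℝ) (A I : Finset N) : Alg N (List N) :=
  getSeqLoop c B A I.card [] I

/-- The marginal gain `f(u ∣ G)`, computed from oracle answers `F`. -/
def gain (F : Finset N → ℝ) (u : N) (G : Finset N) : ℝ := F (insert u G) - F G

/-- The sets to be queried for the marginal gains with respect to `G` of all elements of `L`. -/
def gainQueries (L G : Finset N) : List (Finset N) := G :: L.toList.map (fun u => insert u G)

open Classical in
/-- The elements of `L` that are valuable with respect to `G`: those that can be added to `G` with
marginal density at least `ρ`. -/
def valuable (c : N → ℝ) (B ρ : ℝ) (F : Finset N → ℝ) (L G : Finset N) : Finset N :=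
  L.filter (fun u => ρ ≤ gain F u G / c u ∧ cost c (insert u G) ≤ B)

/-- `G_i = A ∪ {v_1, …, v_i}`. -/
def prefixSet (A : Finset N) (v : List N) (i : ℕ) : Finset N := A ∪ (v.take i).toFinset

/-- The condition `c(E_i⁺) ≤ (1 - ε) c(L)` that defines `t₁`. -/
def costCond (c : N → ℝ) (B ρ ε : ℝ) (A L : Finset N) (v : List N) (F : Finset N → ℝ) (i : ℕ) :
    Prop :=
  cost c (valuable c B ρ F L (prefixSet A v i)) ≤ (1 - ε) * cost c L

open Classical in
/-- The condition
`ε ∑_{u ∈ E_i⁺} f(u ∣ G_i) ≤ ∑_{u ∈ E_i⁻} |f(u ∣ G_i)| + ∑_{v_j ∈ D_i} |f(v_j ∣ A ∪ V_{j-1})|`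
that defines `t₂`. The answers `H` are used for the last sum, where `f(v_j ∣ A ∪ V_{j-1})` is
`f(G_j) - f(G_{j-1})`, and the answers `F` for the others. -/
def valueCond (c : N → ℝ) (B ρ ε : ℝ) (A L : Finset N) (v : List N) (H F : Finset N → ℝ) (i : ℕ) :
    Prop :=
  ε * ∑ u ∈ valuable c B ρ F L (prefixSet A v i), gain F u (prefixSet A v i) ≤
    ∑ u ∈ L.filter (fun u => gain F u (prefixSet A v i) < 0), |gain F u (prefixSet A v i)| +
    ∑ j ∈ (Finset.range i).filter (fun j => H (prefixSet A v (j + 1)) - H (prefixSet A v j) < 0),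
      |H (prefixSet A v (j + 1)) - H (prefixSet A v j)|

/-- The two ways to look for `t₁` and `t₂`: evaluate all prefixes in parallel, or by binary search
over the prefixes. -/
inductive SearchMode
  | exhaustive
  | binary

open Classical in
/-- The smallest `i ≤ d` with `P i` (and `d` if there is none). -/
def firstIndex (P : ℕ → Prop) (d : ℕ) : ℕ :=
  ((List.range (d + 1)).find? (fun i => decide (P i))).getD d

open Classical in
/-- The search for `(t₁, t₂)`. -/
def findBatch (mode : SearchMode) (c : N → ℝ) (B ρ ε : ℝ) (A L : Finset N) (v : List N) :
    Alg N (ℕ × ℕ) :=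
  match mode with
  | .exhaustive => do
    let F ← Alg.ask ((List.range (v.length + 1)).flatMap
      (fun i => gainQueries L (prefixSet A v i)))
    pure (firstIndex (costCond c B ρ ε A L v F) v.length,
      firstIndex (valueCond c B ρ ε A L v F F) v.length)
  | .binary => do
    let H ← Alg.ask ((List.range (v.length + 1)).map (prefixSet A v))
    let t₁ ← Alg.binSearch (fun i => do
      let F ← Alg.ask (gainQueries L (prefixSet A v i))
      pure (decide (costCond c B ρ ε A L v F i))) 0 v.length
    let t₂ ← Alg.binSearch (fun i => do
      let F ← Alg.ask (gainQueries L (prefixSet A v i))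
      pure (decide (valueCond c B ρ ε A L v H F i))) 0 v.length
    pure (t₁, t₂)

open Classical in
/-- The loop of `RandBatch`. At least one element leaves `L` in each pass, so that as many passes
suffice as there are elements in `L` at the start; a run that needs more is an `abort`. -/
def randBatchLoop (mode : SearchMode) (c : N → ℝ) (B ρ : ℝ) (M : ℕ) (p : ℝ≥0) (hp : p ≤ 1)
    (ε : ℝ) : ℕ → Finset N → Finset N → Finset N → ℕ → Alg N (Finset N × Finset N × Finset N)
  | 0, A, U, L, count => if L ≠ ∅ ∧ count < M then .abort else pure (A, U, L)
  | fuel + 1, A, U, L, count =>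
    if L ≠ ∅ ∧ count < M then do
      let v ← getSeq c B A L
      let t ← findBatch mode c B ρ ε A L v
      let V := (v.take (min t.1 t.2)).toFinset
      let U' := U ∪ V
      let accept ← Alg.coin p hp
      let A' := if accept then A ∪ V else A
      let count' := if accept ∧ t.2 < t.1 then count + 1 else count
      let F ← Alg.ask (gainQueries (L \ U') A')
      randBatchLoop mode c B ρ M p hp ε fuel A' U' (valuable c B ρ F (L \ U') A') count'
    else pure (A, U, L)

/-- `RandBatch(ρ, I, M, p, ε, f, c)`, which returns `(A, U, L)`. -/
def randBatch (mode : SearchMode) (c : N → ℝ) (B ρ : ℝ) (I : Finset N) (M : ℕ) (p : ℝ≥0)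
    (hp : p ≤ 1) (ε : ℝ) : Alg N (Finset N × Finset N × Finset N) := do
  let F ← Alg.ask (gainQueries I ∅)
  randBatchLoop mode c B ρ M p hp ε I.card ∅ ∅ (valuable c B ρ F I ∅) 0

/-! ### The algorithms `Probe` and `ParSKP` -/

/-- A set with the largest value among the members of a list, found in one round. -/
def best (l : List (Finset N)) : Alg N (Finset N) := do
  let F ← Alg.ask l
  pure ((l.argmax F).getD ∅)

open Classical in
/-- One step of the augmentation in `Probe`: the best of `T`, `A` and `A ∪ {e}`, where `e` maximizes
`f(A ∪ {u})` over the `u ∈ N₁` with `c(A ∪ {u}) ≤ B` (if there is any). -/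
def augment (c : N → ℝ) (B : ℝ) (N₁ T A : Finset N) : Alg N (Finset N) := do
  let cand := (N₁.filter (fun u => cost c (insert u A) ≤ B)).toList
  let F ← Alg.ask (T :: A :: cand.map (fun u => insert u A))
  match cand.argmax (fun u => F (insert u A)) with
  | none => pure (([T, A].argmax F).getD ∅)
  | some e => pure (([T, A, insert e A].argmax F).getD ∅)

open Classical in
/-- `Probe(ρ, N₁, N₂, ε, f, c)`, with the procedure `usm` for unconstrained submodular
maximization. -/
def probe (mode : SearchMode) (usm : Finset N → Alg N (Finset N)) (c : N → ℝ) (B ρ : ℝ)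
    (N₁ N₂ : Finset N) (ε : ℝ) : Alg N (Finset N) := do
  let M := ⌈(ε ^ 2)⁻¹⌉₊
  let (A₁, _, _) ← randBatch mode c B ρ N₁ M 1 le_rfl ε
  let (A₂, _, _) ← randBatch mode c B ρ (N₁ \ A₁) M 1 le_rfl ε
  let T₁ ← augment c B N₁ ∅ A₁
  let T₂ ← augment c B N₁ T₁ A₂
  if cost c (N₂ ∪ A₁) ≤ B then do
    let A₃ ← usm (N₂ ∪ A₁)
    best [T₂, A₃]
  else pure T₂

/-- The exponents `z ∈ ℤ` of the thresholds `(1 - ε) ^ (-z)` in `[ρmin, ρmax]`. -/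
def exponents (ε ρmin ρmax : ℝ) : Set ℤ :=
  {z : ℤ | (1 - ε) ^ (-z) ∈ Set.Icc ρmin ρmax}

open Classical in
/-- `ParSKP(α, ε, f, c)` for the knapsack constraint `c(S) ≤ B`, with the procedure `usm` for
unconstrained submodular maximization. All runs of `Probe` are executed in parallel. (The set of
thresholds is finite whenever `0 < ε < 1`, `0 < α` and `0 < B`.) -/
def parSKP [Fintype N] (mode : SearchMode) (usm : Finset N → Alg N (Finset N)) (α ε : ℝ)
    (c : N → ℝ) (B : ℝ) : Alg N (Finset N) := do
  let n : ℝ := Fintype.card N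
  let N₁ : Finset N := Finset.univ.filter (fun u => ε * (B / n) < c u)
  let N₂ : Finset N := Finset.univ \ N₁
  let F ← Alg.ask ((Finset.univ : Finset N).toList.map (fun u => {u}))
  match (Finset.univ : Finset N).toList.argmax (fun u => F {u}) with
  | none => usm N₂
  | some w => do
    let S₀ ← usm N₂
    let S₁ ← best [S₀, {w}]
    let ρmin := α * F {w} / B
    let ρmax := n ^ 2 * α * F {w} / (ε * B)
    if hZ : (exponents ε ρmin ρmax).Finite then do
      let Ts ← Alg.parAll (hZ.toFinset.toList.flatMap (fun z =>
        List.replicate ⌈Real.logb (1 - ε) ε⌉₊ (probe mode usm c B ((1 - ε) ^ (-z)) N₁ N₂ ε)))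
      best (S₁ :: Ts)
    else .abort

end ParSubmod

end

/-! Everything is a worst-case count along a single run, so no probability enters: shuffles are used
only through being permutations, and with `p = 1` every batch is accepted.

The core is the number of passes of `RandBatch`, controlled by a two-part potential
(`within_randBatchLoop`). If `t₂ < t₁`, the pass raises `count`, which can happen at most `M =
⌈ε⁻²⌉` times. Otherwise `t* = t₁`, the new `L` lies in the set `E⁺` at `t₁`, and `c(L)` shrinks by a
factor `1 - ε`. Initially `c(L) ≤ nB`, while every element of `N₁` costs more than `εB/n`; hence `L`
must be empty once `(1 - ε)^k ≤ ε/n²`, so that `k = O(log n)` passes of the second kind suffice.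
Termination is a separate matter: `t* ≥ 1` (`within_findBatch`), so each pass removes at least the
first element of the sequence from `L`, and the fuel never runs out.

A pass costs 2 rounds and `O(nr)` queries with exhaustive search, and `O(log r)` rounds and `O(n log
r)` queries with binary search. The endpoints of the threshold interval have ratio `n²/ε`, so there
are `O(log n)` thresholds (`exponents_finite_card_le`), each with a number of repetitions depending
only on `ε`. Parallel runs share rounds but add queries: one factor `log n` in the rounds, two in
the queries.

The search need not find the true least indices. All that is needed is that the returned `t₁`
satisfies the cost condition and that both indices are positive; this holds without any monotonicity
of the tests. -/

namespace ParSubmod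

/-! ### A calculus of simultaneous round, query and output bounds. -/

namespace Alg

variable {N α β : Type} [DecidableEq N]

/-- On the oracle `f`, every run of the algorithm delivers an output with property `P`, within `r`
rounds and `q` queries. -/
inductive Within (f : Finset N → ℝ) (P : α → Prop) : ℕ → ℕ → Alg N α → Prop
  | pure {a : α} (r q : ℕ) (h : P a) : Within f P r q (.pure a)
  | toss {Ω : Type} {μ : PMF Ω} {k : Ω → Alg N α} {r q : ℕ}
      (h : ∀ ω ∈ μ.support, Within f P r q (k ω)) : Within f P r q (.toss μ k)
  | round {qs : List (Finset N)} {k : (Finset N → ℝ) → Alg N α} {r q : ℕ}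
      (h : Within f P r q (k (mask qs f))) : Within f P (r + 1) (qs.length + q) (.round qs k)

variable {f : Finset N → ℝ} {P : α → Prop}

theorem Within.mono {P' : α → Prop} {x : Alg N α} {r q r' q' : ℕ} (h : Within f P r q x)
    (hP : ∀ a, P a → P' a) (hr : r ≤ r') (hq : q ≤ q') : Within f P' r' q' x := by
  induction h generalizing r' q' with
  | pure r q h => exact .pure _ _ (hP _ h)
  | toss h ih => exact .toss fun ω hω => ih ω hω hr hq
  | @round qs k r q h ih =>
    obtain ⟨r'', rfl⟩ : ∃ r'', r' = r'' + 1 := ⟨r' - 1, by omega⟩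
    obtain ⟨q'', rfl⟩ : ∃ q'', q' = qs.length + q'' := ⟨q' - qs.length, by omega⟩
    exact .round (ih (by omega) (by omega))

/-- Budgets add under composition, and the postcondition of the first stage is what the bound on the
second stage may assume. -/
theorem Within.bind {P' : β → Prop} {x : Alg N α} {g : α → Alg N β} {r q r' q' : ℕ}
    (h : Within f P r q x) (hg : ∀ a, P a → Within f P' r' q' (g a)) :
    Within f P' (r + r') (q + q') (x >>= g) := by
  change Within f P' (r + r') (q + q') (Alg.bind x g)
  induction h with
  | pure r q h => exact (hg _ h).mono (fun _ => id) (by omega) (by omega)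
  | toss h ih => exact .toss ih
  | @round qs k r q h ih =>
    rw [show r + 1 + r' = (r + r') + 1 by omega, add_assoc qs.length]
    exact .round (k := fun F => Alg.bind (k F) g) ih

theorem Within.ask (qs : List (Finset N)) :
    Within f (fun F => F = mask qs f) 1 qs.length (Alg.ask qs) :=
  .round (k := Alg.pure) (r := 0) (q := 0) (.pure 0 0 rfl)

theorem Within.rounds_le {x : Alg N α} {r q : ℕ} (h : Within f P r q x) : x.rounds f ≤ r := by
  induction h with
  | pure r q h => simp [rounds]
  | toss h ih => exact iSup₂_le ih
  | round h ih =>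
    rw [rounds, Nat.cast_add, Nat.cast_one, add_comm]
    gcongr

theorem Within.queries_le {x : Alg N α} {r q : ℕ} (h : Within f P r q x) : x.queries f ≤ q := by
  induction h with
  | pure r q h => simp [queries]
  | toss h ih => exact iSup₂_le ih
  | round h ih =>
    rw [queries, Nat.cast_add]
    gcongr

/-- Converse of the two bounds above, needed to bring the assumption on `usm` into the calculus;
`abort` is excluded because it counts as `⊤` rounds. -/
theorem within_of_le {x : Alg N α} {r q : ℕ} (hr : x.rounds f ≤ r) (hq : x.queries f ≤ q) :
    Within f (fun _ => True) r q x := by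
  induction x generalizing r q with
  | pure a => exact .pure _ _ trivial
  | abort => simp [rounds] at hr
  | toss μ k ih =>
    rw [rounds, iSup₂_le_iff] at hr
    rw [queries, iSup₂_le_iff] at hq
    exact .toss fun ω hω => ih ω (hr ω hω) (hq ω hω)
  | round qs k ih =>
    rw [rounds] at hr
    rw [queries] at hq
    have h1 : 1 ≤ r := by exact_mod_cast le_self_add.trans hr
    have h2 : qs.length ≤ q := by exact_mod_cast le_self_add.trans hq
    obtain ⟨r, rfl⟩ := Nat.exists_eq_add_of_le' h1
    obtain ⟨q, rfl⟩ := Nat.exists_eq_add_of_le h2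
    refine .round (ih _ ?_ ?_)
    · rw [Nat.cast_add, Nat.cast_one, add_comm] at hr
      exact (ENat.add_le_add_iff_right (by simp)).1 hr
    · rw [Nat.cast_add] at hq
      exact (ENat.add_le_add_iff_left (by simp)).1 hq

/-- In a merged round each of the two algorithms still receives exactly the answers it would receive
alone, so its separate bound remains applicable. -/
theorem mask_mask_append_left (qs qs' : List (Finset N)) (f : Finset N → ℝ) :
    mask qs (mask (qs ++ qs') f) = mask qs f := by
  funext S
  by_cases h : S ∈ qs <;> simp [mask, h]

theorem mask_mask_append_right (qs qs' : List (Finset N)) (f : Finset N → ℝ) :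
    mask qs' (mask (qs ++ qs') f) = mask qs' f := by
  funext S
  by_cases h : S ∈ qs' <;> simp [mask, h]

/-- Lockstep execution: a common round budget `r` serves both sides, while the query budgets add. -/
theorem Within.par {P' : β → Prop} {x : Alg N α} {y : Alg N β} {r q q' : ℕ}
    (hx : Within f P r q x) (hy : Within f P' r q' y) :
    Within f (fun p => P p.1 ∧ P' p.2) r (q + q') (Alg.par x y) := by
  induction hx generalizing y q' with
  | pure r q h =>
    rw [Alg.par]
    have := hy.bind (P' := fun p : _ × β => P p.1 ∧ P' p.2) (r' := 0) (q' := 0)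
      (g := fun b => Alg.pure (_, b)) (fun b hb => .pure 0 0 ⟨h, hb⟩)
    exact this.mono (fun _ => id) (by omega) (by omega)
  | toss h ih =>
    rw [Alg.par]
    exact .toss fun ω hω => ih ω hω hy
  | @round qs k r q h ih =>
    rw [Alg.par]
    -- The first algorithm waits at a round while the coin tosses of the second are resolved, hence
    -- an inner induction on the second, with its round budget freed as an index.
    generalize hr' : r + 1 = r' at hy
    induction hy with
    | pure r' q' hb =>
      subst hr'
      rw [parRound, add_assoc]
      exact .round (ih (.pure _ _ hb))
    | toss h' ih' =>
      rw [parRound]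
      exact .toss fun ω hω => ih' ω hω hr'
    | @round qs' k' r' q' h' ih' =>
      obtain rfl : r = r' := by omega
      rw [parRound, show qs.length + q + (qs'.length + q') = (qs ++ qs').length + (q + q') by
        rw [List.length_append]; omega]
      refine .round ?_
      rw [mask_mask_append_left, mask_mask_append_right]
      exact ih h'

theorem Within.parAll {xs : List (Alg N α)} {r q : ℕ} (h : ∀ x ∈ xs, Within f P r q x) :
    Within f (fun l => l.length = xs.length) r (xs.length * q) (Alg.parAll xs) := by
  induction xs with
  | nil => exact .pure _ _ rfl
  | cons x xs ih =>
    have := ((h x (by simp)).par (ih fun y hy => h y (by simp [hy]))).bind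
      (P' := fun l => l.length = (x :: xs).length) (r' := 0) (q' := 0)
      (g := fun p => Alg.pure (p.1 :: p.2)) (fun p hp => .pure 0 0 (by simp [hp.2]))
    refine this.mono (fun _ => id) (by omega) ?_
    rw [List.length_cons, add_mul, one_mul]
    omega

theorem within_shuffle (I : Finset N) :
    Within f (fun l => l.Perm I.toList) 0 0 (shuffle I) := by
  refine .toss fun σ _ => .pure 0 0 ?_
  have := List.ofFn_get I.toList
  conv_rhs => rw [← this]
  exact Equiv.Perm.ofFn_comp_perm σ I.toList.get

theorem within_coin_one : Within f (fun b => b = true) 0 0 (coin 1 le_rfl) := by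
  refine .toss fun b hb => .pure 0 0 ?_
  rw [PMF.mem_support_iff] at hb
  by_contra h
  simp [h] at hb

/-- The upper end only ever moves to an index whose test succeeded, so the result is the original
`hi` or has passed the test, whether or not the test is monotone. -/
theorem within_binSearch {test : ℕ → Alg N Bool} {T : ℕ → Prop} {r q : ℕ}
    (ht : ∀ i, Within f (fun b => b = true → T i) r q (test i)) (m lo hi : ℕ) (h : lo ≤ hi)
    (hm : hi - lo < 2 ^ m) :
    Within f (fun i => i = hi ∨ T i) (m * r) (m * q) (binSearch test lo hi) := by
  induction m generalizing lo hi with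
  | zero =>
    rw [binSearch, if_neg (by simp at hm; omega)]
    exact .pure _ _ (Or.inl (by simp at hm; omega))
  | succ m ih =>
    rw [binSearch]
    split_ifs with hlt
    · rw [add_mul, add_mul, one_mul, one_mul, add_comm _ r, add_comm _ q]
      rw [pow_succ] at hm
      refine (ht _).bind fun b hb => ?_
      split_ifs with hbt
      · refine (ih lo ((lo + hi) / 2) (by omega) (by omega)).mono ?_ le_rfl le_rfl
        rintro i (rfl | hi)
        · exact Or.inr (hb hbt)
        · exact Or.inr hi
      · exact ih _ _ (by omega) (by omega)
    · exact .pure _ _ (Or.inl (by omega))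

end Alg

end ParSubmod

namespace ParSubmod

open Alg

variable {N : Type} {f : Finset N → ℝ} {c : N → ℝ} {B : ℝ}

/-! ### Costs and feasible cardinalities. -/

theorem cost_mono (hc : ∀ u, 0 < c u) {X Y : Finset N} (h : X ⊆ Y) : cost c X ≤ cost c Y :=
  Finset.sum_le_sum_of_subset_of_nonneg h fun u _ _ => (hc u).le

theorem card_le_maxCard [Fintype N] {X : Finset N} (h : cost c X ≤ B) : X.card ≤ maxCard c B := by
  classical
  exact Finset.le_sup (f := Finset.card) (by simp [h])

theorem maxCard_le_card [Fintype N] (c : N → ℝ) (B : ℝ) : maxCard c B ≤ Fintype.card N :=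
  Finset.sup_le fun X _ => Finset.card_le_univ X

theorem cost_pos (hc : ∀ u, 0 < c u) {L : Finset N} (hL : L ≠ ∅) : 0 < cost c L :=
  Finset.sum_pos (fun u _ => hc u) (Finset.nonempty_iff_ne_empty.2 hL)

/-! ### `GetSEQ` -/

variable [DecidableEq N]

/-- `v` is a maximal sequence of elements of `L` that can be added to `A`. -/
structure IsMaximalSeq (c : N → ℝ) (B : ℝ) (A L : Finset N) (v : List N) : Prop where
  nodup : v.Nodup
  subset : v.toFinset ⊆ L
  feasible : cost c (A ∪ v.toFinset) ≤ B
  maximal : ∀ u ∈ L, u ∉ v → ¬ cost c (insert u (A ∪ v.toFinset)) ≤ B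

/-- Each remaining element fits on its own, so every pass appends at least the first element of the
permutation, and `|I|` drops. An element that has been discarded stays infeasible as `V` grows,
which gives maximality. -/
theorem within_getSeqLoop (hc : ∀ u, 0 < c u) {A L : Finset N} {fuel : ℕ} {V : List N}
    {I : Finset N} (hcard : I.card ≤ fuel) (hV : V.Nodup) (hVL : V.toFinset ⊆ L) (hIL : I ⊆ L)
    (hVI : Disjoint V.toFinset I) (hVB : cost c (A ∪ V.toFinset) ≤ B)
    (hIB : ∀ u ∈ I, cost c (insert u (A ∪ V.toFinset)) ≤ B)
    (hmax : ∀ u ∈ L, u ∉ V → u ∉ I → ¬ cost c (insert u (A ∪ V.toFinset)) ≤ B) :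
    Within f (IsMaximalSeq c B A L) 0 0 (getSeqLoop c B A fuel V I) := by
  induction fuel generalizing V I with
  | zero =>
    obtain rfl : I = ∅ := by simpa using hcard
    rw [getSeqLoop, if_pos rfl]
    exact .pure 0 0 ⟨hV, hVL, hVB, fun u hu huV => hmax u hu huV (by simp)⟩
  | succ fuel ih =>
    rw [getSeqLoop]
    split_ifs with hI
    · subst hI
      exact .pure 0 0 ⟨hV, hVL, hVB, fun u hu huV => hmax u hu huV (by simp)⟩
    refine (within_shuffle I).bind (r' := 0) (q' := 0) fun l hl => ?_
    set s := Nat.findGreatest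
      (fun i => cost c (A ∪ V.toFinset ∪ (l.take i).toFinset) ≤ B) l.length with hs
    have hlI : ∀ u, u ∈ l ↔ u ∈ I := fun u => by rw [hl.mem_iff, Finset.mem_toList]
    have hlnd : l.Nodup := hl.nodup_iff.2 I.nodup_toList
    have hsB : cost c (A ∪ V.toFinset ∪ (l.take s).toFinset) ≤ B :=
      Nat.findGreatest_spec (P := fun i => cost c (A ∪ V.toFinset ∪ (l.take i).toFinset) ≤ B)
        (Nat.zero_le _) (by simpa using hVB)
    obtain ⟨w, l', rfl⟩ : ∃ w l', l = w :: l' := by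
      cases l with
      | nil =>
        obtain ⟨u, hu⟩ := Finset.nonempty_iff_ne_empty.2 hI
        simpa using (hlI u).2 hu
      | cons w l' => exact ⟨w, l', rfl⟩
    have hwI : w ∈ I := (hlI w).1 (by simp)
    have hs1 : 1 ≤ s := by
      refine Nat.le_findGreatest (by simp) ?_
      simpa [Finset.union_comm _ {w}] using hIB w hwI
    have hw : w ∈ (w :: l').take s := by
      obtain ⟨s', hs'⟩ := Nat.exists_eq_add_of_le' hs1
      rw [hs']; simp
    have htake : ∀ u ∈ (w :: l').take s, u ∈ I := fun u hu => (hlI u).1 (List.mem_of_mem_take hu)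
    have hVt : (V ++ (w :: l').take s).toFinset = V.toFinset ∪ ((w :: l').take s).toFinset :=
      List.toFinset_append
    refine ih ?_ ?_ ?_ ?_ ?_ ?_ ?_ ?_
    · refine Nat.lt_succ_iff.1 (lt_of_lt_of_le (Finset.card_lt_card ?_) hcard)
      refine Finset.ssubset_iff_of_subset ?_ |>.2 ⟨w, hwI, ?_⟩
      · exact (Finset.filter_subset _ _).trans Finset.sdiff_subset
      · simp [hw]
    · refine List.nodup_append'.2 ⟨hV, hlnd.sublist (List.take_sublist _ _), ?_⟩
      intro u hu hu'
      exact Finset.disjoint_left.1 hVI (List.mem_toFinset.2 hu) (htake u hu')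
    · rw [hVt]
      refine Finset.union_subset hVL fun u hu => hIL (htake u (List.mem_toFinset.1 hu))
    · exact ((Finset.filter_subset _ _).trans Finset.sdiff_subset).trans hIL
    · exact (Finset.disjoint_sdiff).mono_right (Finset.filter_subset _ _)
    · rw [hVt, ← Finset.union_assoc]
      exact hsB
    · intro u hu
      exact (Finset.mem_filter.1 hu).2
    · intro u huL huV huI hcost
      rw [List.mem_append, not_or] at huV
      by_cases hu : u ∈ I
      · exact huI (by simp [hu, huV.1, huV.2] at hcost ⊢; exact hcost)
      -- Here `u` was discarded in an earlier pass; if it fitted now, it would have fitted beside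
      -- the smaller `V`.
      · refine hmax u huL huV.1 hu ((cost_mono hc ?_).trans hcost)
        rw [hVt]
        gcongr
        exact Finset.subset_union_left

theorem within_getSeq (hc : ∀ u, 0 < c u) {A L : Finset N} (hA : cost c A ≤ B)
    (hL : ∀ u ∈ L, cost c (insert u A) ≤ B) :
    Within f (IsMaximalSeq c B A L) 0 0 (getSeq c B A L) :=
  within_getSeqLoop hc le_rfl List.nodup_nil (by simp) Finset.Subset.rfl (by simp)
    (by simpa using hA) (by simpa using hL) (by simp +contextual)

/-! ### The search for a batch -/

/-- The answers `F` agree with `f` on the marginal gains with respect to `G` of elements of `L`. -/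
def GainsAgree (F f : Finset N → ℝ) (L G : Finset N) : Prop :=
  ∀ u ∈ L, gain F u G = gain f u G

theorem gainsAgree_mask {qs : List (Finset N)} {L G : Finset N}
    (h : ∀ S ∈ gainQueries L G, S ∈ qs) : GainsAgree (mask qs f) f L G := by
  intro u hu
  have h₁ : G ∈ qs := h _ (by simp [gainQueries])
  have h₂ : insert u G ∈ qs :=
    h _ (List.mem_cons_of_mem _ (List.mem_map.2 ⟨u, Finset.mem_toList.2 hu, rfl⟩))
  simp [gain, mask, h₁, h₂]

theorem length_gainQueries (L G : Finset N) : (gainQueries L G).length = L.card + 1 := by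
  simp [gainQueries]

theorem GainsAgree.valuable_eq {F : Finset N → ℝ} {L G : Finset N} {ρ : ℝ}
    (h : GainsAgree F f L G) : valuable c B ρ F L G = valuable c B ρ f L G :=
  Finset.filter_congr fun u hu => by rw [h u hu]

theorem firstIndex_spec {P : ℕ → Prop} {d : ℕ} (h : P d) : P (firstIndex P d) := by
  classical
  unfold firstIndex
  cases hfind : (List.range (d + 1)).find? (fun i => decide (P i)) with
  | none => simpa using h
  | some i => simpa using List.find?_some hfind

theorem one_le_firstIndex {P : ℕ → Prop} {d : ℕ} (hd : 1 ≤ d) (h : ¬ P 0) :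
    1 ≤ firstIndex P d := by
  classical
  unfold firstIndex
  cases hfind : (List.range (d + 1)).find? (fun i => decide (P i)) with
  | none => simpa using hd
  | some i =>
    have : P i := by simpa using List.find?_some hfind
    rcases Nat.eq_zero_or_pos i with rfl | hi
    · exact absurd this h
    · exact hi

section Conditions

variable {ρ ε : ℝ} {A L : Finset N} {v : List N}

theorem prefixSet_zero (A : Finset N) (v : List N) : prefixSet A v 0 = A := by simp [prefixSet]

theorem prefixSet_length (A : Finset N) (v : List N) :
    prefixSet A v v.length = A ∪ v.toFinset := by simp [prefixSet]

theorem GainsAgree.costCond_iff {F : Finset N → ℝ} {i : ℕ}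
    (h : GainsAgree F f L (prefixSet A v i)) :
    costCond c B ρ ε A L v F i ↔ costCond c B ρ ε A L v f i := by
  rw [costCond, costCond, h.valuable_eq]

theorem not_costCond_zero (hc : ∀ u, 0 < c u) (hε : 0 < ε) (hL : L ≠ ∅)
    (hLA : valuable c B ρ f L A = L) : ¬ costCond c B ρ ε A L v f 0 := by
  rw [costCond, prefixSet_zero, hLA]
  nlinarith [cost_pos hc hL]

/-- After the whole sequence no element is valuable: those in `v` have gain `0`, below the positive
threshold, and the others no longer fit, by maximality. -/
theorem costCond_length (hc : ∀ u, 0 < c u) (hε : ε ≤ 1) (hρ : 0 < ρ)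
    (hv : IsMaximalSeq c B A L v) : costCond c B ρ ε A L v f v.length := by
  have : valuable c B ρ f L (prefixSet A v v.length) = ∅ := by
    refine Finset.filter_eq_empty_iff.2 ?_
    rintro u hu ⟨hgain, hcost⟩
    rw [prefixSet_length] at hgain hcost
    by_cases huv : u ∈ v
    · rw [gain, Finset.insert_eq_of_mem (by simp [huv])] at hgain
      simp at hgain
      linarith
    · exact hv.maximal u hu huv hcost
  rw [costCond, this]
  exact (show cost c ∅ = 0 by simp [cost]) ▸
    mul_nonneg (by linarith) (Finset.sum_nonneg fun u _ => (hc u).le)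

/-- At `i = 0` all of `L` has positive gain, so the right-hand side consists of empty sums. This is
also why the answers `H` may be arbitrary. -/
theorem not_valueCond_zero (hc : ∀ u, 0 < c u) (hε : 0 < ε) (hρ : 0 < ρ) (hL : L ≠ ∅)
    (hLA : valuable c B ρ f L A = L) {H F : Finset N → ℝ} (hF : GainsAgree F f L A) :
    ¬ valueCond c B ρ ε A L v H F 0 := by
  have hpos : ∀ u ∈ L, 0 < gain F u A := by
    intro u hu
    rw [hF u hu]
    rw [← hLA] at hu
    exact (div_pos_iff_of_pos_right (hc u)).1 (hρ.trans_le (Finset.mem_filter.1 hu).2.1)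
  rw [valueCond, prefixSet_zero, hF.valuable_eq, hLA,
    Finset.filter_eq_empty_iff.2 fun u hu => (hpos u hu).le.not_gt]
  simp only [Finset.range_zero, Finset.filter_empty, Finset.sum_empty, add_zero, not_le]
  exact mul_pos hε (Finset.sum_pos hpos (Finset.nonempty_iff_ne_empty.2 hL))

/-- The number of rounds of the search for `t₁` and `t₂` in a sequence of at most `r` elements. -/
def searchRounds (r : ℕ) : SearchMode → ℕ
  | .exhaustive => 1
  | .binary => 1 + 2 * (Nat.log 2 r + 1)

/-- The number of queries of the search for `t₁` and `t₂` in a sequence of at most `r` elements,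
which belong to a set of at most `n` elements. -/
def searchQueries (n r : ℕ) : SearchMode → ℕ
  | .exhaustive => (r + 1) * (n + 1)
  | .binary => (n + 1) + 2 * ((Nat.log 2 r + 1) * (n + 1))

theorem within_findBatch (hc : ∀ u, 0 < c u) (hε₀ : 0 < ε) (hε₁ : ε < 1) (hρ : 0 < ρ)
    (hL : L ≠ ∅) (hLA : valuable c B ρ f L A = L) (hv : IsMaximalSeq c B A L v)
    (hv1 : 1 ≤ v.length) {n r : ℕ} (hn : L.card ≤ n) (hr : v.length ≤ r) (hrn : r ≤ n)
    (mode : SearchMode) :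
    Within f (fun t => costCond c B ρ ε A L v f t.1 ∧ 1 ≤ t.1 ∧ 1 ≤ t.2) (searchRounds r mode)
      (searchQueries n r mode) (findBatch mode c B ρ ε A L v) := by
  have hd := costCond_length (f := f) hc hε₁.le hρ hv
  have h0 := not_costCond_zero (v := v) hc hε₀ hL hLA
  cases mode with
  | exhaustive =>
    refine Within.mono (r := 1 + 0) (q := _ + 0)
      ((Within.ask ((List.range (v.length + 1)).flatMap
        (fun i => gainQueries L (prefixSet A v i)))).bind fun F hF => Within.pure 0 0 ?_)
      (fun _ => id) le_rfl ?_
    · have hagree : ∀ i ≤ v.length, GainsAgree F f L (prefixSet A v i) := by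
        intro i hi
        rw [hF]
        exact gainsAgree_mask fun S hS =>
          List.mem_flatMap.2 ⟨i, List.mem_range.2 (by omega), hS⟩
      -- The index found must lie in the queried range, since only there do the answers `F` speak
      -- about `f`.
      have hle : firstIndex (costCond c B ρ ε A L v F) v.length ≤ v.length := by
        classical
        unfold firstIndex
        cases hfind : (List.range (v.length + 1)).find?
            (fun i => decide (costCond c B ρ ε A L v F i)) with
        | none => simp
        | some i => simpa using Nat.lt_succ_iff.1 (List.mem_range.1 (List.mem_of_find?_eq_some hfind))
      refine ⟨(hagree _ hle).costCond_iff.1 (firstIndex_spec ((hagree _ le_rfl).costCond_iff.2 hd)),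
        one_le_firstIndex hv1 fun h => h0 ((hagree 0 (Nat.zero_le _)).costCond_iff.1 h),
        one_le_firstIndex hv1 (not_valueCond_zero hc hε₀ hρ hL hLA ?_)⟩
      simpa [prefixSet_zero] using hagree 0 (Nat.zero_le _)
    · simp only [List.length_flatMap, length_gainQueries, List.map_const', List.length_range,
        List.sum_replicate, smul_eq_mul, add_zero]
      exact Nat.mul_le_mul (by omega) (by omega)
  | binary =>
    have hm : v.length - 0 < 2 ^ (Nat.log 2 r + 1) :=
      lt_of_le_of_lt (by omega) (Nat.lt_pow_succ_log_self (by norm_num) r)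
    have hask : ∀ i, Within f (fun F => GainsAgree F f L (prefixSet A v i)) 1 (n + 1)
        (Alg.ask (gainQueries L (prefixSet A v i))) := fun i =>
      (Within.ask _).mono (fun F hF => hF ▸ gainsAgree_mask fun S hS => hS) le_rfl
        (by rw [length_gainQueries]; omega)
    refine Within.mono (r := 1 + ((Nat.log 2 r + 1) * 1 + ((Nat.log 2 r + 1) * 1 + 0)))
      (q := _ + ((Nat.log 2 r + 1) * (n + 1) + ((Nat.log 2 r + 1) * (n + 1) + 0)))
      ((Within.ask ((List.range (v.length + 1)).map (prefixSet A v))).bind fun H hH =>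
        (within_binSearch (T := costCond c B ρ ε A L v f) (fun i => ?_) _ 0 v.length
          (Nat.zero_le _) hm).bind fun t₁ ht₁ =>
        -- For `t₂` only positivity matters, so the property tracked is being nonzero.
        (within_binSearch (T := fun i => i ≠ 0) (fun i => ?_) _ 0 v.length
          (Nat.zero_le _) hm).bind fun t₂ ht₂ => Within.pure 0 0 ?_)
      (fun _ => id) ?_ ?_
    · refine (hask i).bind (r' := 0) (q' := 0) fun F hF => Within.pure 0 0 ?_
      intro h
      exact hF.costCond_iff.1 (by simpa using h)
    · refine (hask i).bind (r' := 0) (q' := 0) fun F hF => Within.pure 0 0 ?_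
      rintro h rfl
      rw [prefixSet_zero] at hF
      exact not_valueCond_zero hc hε₀ hρ hL hLA hF (by simpa using h)
    · have h1 : costCond c B ρ ε A L v f t₁ := by
        rcases ht₁ with rfl | h
        · exact hd
        · exact h
      refine ⟨h1, Nat.one_le_iff_ne_zero.2 fun h => h0 (h ▸ h1), ?_⟩
      rcases ht₂ with rfl | h
      · exact hv1
      · exact Nat.one_le_iff_ne_zero.2 h
    · simp only [searchRounds]; omega
    · simp only [searchQueries, List.length_map, List.length_range]; omega

end Conditions

end ParSubmod

namespace ParSubmod

open Alg

variable {N : Type} [DecidableEq N] {f : Finset N → ℝ} {c : N → ℝ} {B : ℝ}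

theorem within_best (l : List (Finset N)) : Within f (fun _ => True) 1 l.length (best l) :=
  (Within.ask l).bind (r' := 0) (q' := 0) fun _ _ => .pure 0 0 trivial

/-! ### `RandBatch` -/

theorem valuable_valuable {ρ : ℝ} (L G : Finset N) :
    valuable c B ρ f (valuable c B ρ f L G) G = valuable c B ρ f L G := by
  classical
  simp [valuable, Finset.filter_filter]

variable [Fintype N]

/-- The number of rounds of one pass of the loop of `RandBatch`. -/
noncomputable def passRounds (c : N → ℝ) (B : ℝ) (mode : SearchMode) : ℕ :=
  searchRounds (maxCard c B) mode + 1

/-- The number of queries of one pass of the loop of `RandBatch`. -/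
noncomputable def passQueries (c : N → ℝ) (B : ℝ) (mode : SearchMode) : ℕ :=
  searchQueries (Fintype.card N) (maxCard c B) mode + (Fintype.card N + 1)

/-- The potential is `m + k`: `m` bounds the remaining increments of `count`, and `k` the remaining
shrinkings of `c(L)` by `1 - ε` before it falls to `δ`, below the cost of any single element. Each
pass lowers one of the two. -/
theorem within_randBatchLoop (mode : SearchMode) (hc : ∀ u, 0 < c u) {ε ρ δ : ℝ} (hε₀ : 0 < ε)
    (hε₁ : ε < 1) (hρ : 0 < ρ) {M fuel : ℕ} {A U L : Finset N} {count m k : ℕ}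
    (hδ : ∀ u ∈ L, δ < c u) (hk : (1 - ε) ^ k * cost c L ≤ δ) (hM : M ≤ count + m)
    (hfuel : L.card ≤ fuel) (hA : cost c A ≤ B) (hLA : valuable c B ρ f L A = L) :
    Within f (fun _ => True) ((m + k) * passRounds c B mode) ((m + k) * passQueries c B mode)
      (randBatchLoop mode c B ρ M 1 le_rfl ε fuel A U L count) := by
  induction fuel generalizing A U L count m k with
  | zero =>
    obtain rfl : L = ∅ := by simpa using hfuel
    rw [randBatchLoop, if_neg (by simp)]
    exact .pure _ _ trivial
  | succ fuel ih =>
    rw [randBatchLoop]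
    split_ifs with hcond
    swap
    · exact .pure _ _ trivial
    obtain ⟨hL, hcount⟩ := hcond
    obtain ⟨m, rfl⟩ : ∃ m', m = m' + 1 := ⟨m - 1, by omega⟩
    have hLB : ∀ u ∈ L, cost c (insert u A) ≤ B := by
      intro u hu
      rw [← hLA] at hu
      exact (Finset.mem_filter.1 hu).2.2
    have hLne := Finset.nonempty_iff_ne_empty.2 hL
    refine Within.mono
      -- The zeros are `GetSEQ` and the coin, which make no queries; the search and the update of
      -- `L` make up the pass.
      (r := 0 + (searchRounds (maxCard c B) mode + (0 + (1 + (m + k) * passRounds c B mode))))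
      (q := 0 + (searchQueries (Fintype.card N) (maxCard c B) mode +
        (0 + (Fintype.card N + 1 + (m + k) * passQueries c B mode)))) ?_ (fun _ => id)
      (by rw [show m + 1 + k = m + k + 1 by omega, add_mul _ 1, one_mul, passRounds]; omega)
      (by rw [show m + 1 + k = m + k + 1 by omega, add_mul _ 1, one_mul, passQueries]; omega)
    refine (within_getSeq hc hA hLB).bind fun v hv => ?_
    have hv1 : 1 ≤ v.length := by
      rw [Nat.one_le_iff_ne_zero]
      intro h
      obtain rfl := List.length_eq_zero_iff.1 h
      obtain ⟨u, hu⟩ := hLne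
      exact hv.maximal u hu (by simp) (by simpa using hLB u hu)
    have hvr : v.length ≤ maxCard c B := by
      rw [← List.toFinset_card_of_nodup hv.nodup]
      exact card_le_maxCard ((cost_mono hc Finset.subset_union_right).trans hv.feasible)
    refine (within_findBatch hc hε₀ hε₁ hρ hL hLA hv hv1 (Finset.card_le_univ L) hvr
      (maxCard_le_card c B) mode).bind ?_
    rintro ⟨t₁, t₂⟩ ⟨ht₁, h1, h2⟩
    dsimp only at ht₁ h1 h2 ⊢
    refine within_coin_one.bind ?_
    rintro _ rfl
    simp only [if_true, true_and]
    refine Within.bind ((Within.ask _).mono (P' := fun F => F = mask _ f) (fun _ => id) le_rfl ?_)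
      fun F hF => ?_
    · rw [length_gainQueries]
      exact Nat.succ_le_succ (Finset.card_le_univ _)
    set V := (v.take (min t₁ t₂)).toFinset with hV
    have hagree : GainsAgree F f (L \ (U ∪ V)) (A ∪ V) := by
      rw [hF]
      exact gainsAgree_mask fun S hS => hS
    rw [hagree.valuable_eq]
    set L' := valuable c B ρ f (L \ (U ∪ V)) (A ∪ V) with hL'
    have hL'L : L' ⊆ L := (Finset.filter_subset _ _).trans Finset.sdiff_subset
    have hδ' : ∀ u ∈ L', δ < c u := fun u hu => hδ u (hL'L hu)
    have hVv : V ⊆ v.toFinset := fun u hu =>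
      List.mem_toFinset.2 (List.mem_of_mem_take (List.mem_toFinset.1 hu))
    have hA' : cost c (A ∪ V) ≤ B :=
      (cost_mono hc (Finset.union_subset_union_right hVv)).trans hv.feasible
    have hcard : L'.card ≤ fuel := by
      refine Nat.lt_succ_iff.1 (lt_of_lt_of_le (Finset.card_lt_card ?_) hfuel)
      obtain ⟨w, v', rfl⟩ := List.exists_cons_of_length_pos hv1
      have hw : w ∈ V := by
        obtain ⟨s, hs⟩ := Nat.exists_eq_add_of_le' (le_min h1 h2)
        rw [hV, hs]; simp
      refine (Finset.ssubset_iff_of_subset hL'L).2 ⟨w, hv.subset (by simp), fun hwL => ?_⟩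
      have := Finset.mem_sdiff.1 ((Finset.filter_subset _ _) hwL)
      exact this.2 (Finset.mem_union_right _ hw)
    have hpow : (0 : ℝ) ≤ (1 - ε) ^ k := pow_nonneg (by linarith) _
    split_ifs with ht
    · exact ih hδ' ((mul_le_mul_of_nonneg_left (cost_mono hc hL'L) hpow).trans hk) (by omega)
        hcard hA' (valuable_valuable _ _)
    -- With `k = 0` the whole of `L` would cost at most `δ`, although each of its elements costs
    -- more.
    · obtain ⟨k, rfl⟩ : ∃ k', k = k' + 1 := by
        refine Nat.exists_eq_add_one_of_ne_zero ?_
        rintro rfl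
        obtain ⟨u, hu⟩ := hLne
        have : c u ≤ cost c L := Finset.single_le_sum (fun u _ => (hc u).le) hu
        linarith [hδ u hu]
      rw [show m + (k + 1) = m + 1 + k by omega]
      refine ih hδ' ?_ (by omega) hcard hA' (valuable_valuable _ _)
      have hsub : cost c L' ≤ (1 - ε) * cost c L := by
        refine (cost_mono hc ?_).trans ht₁
        rw [hL', hV, min_eq_left (not_lt.1 ht)]
        exact Finset.filter_subset_filter _ Finset.sdiff_subset
      calc (1 - ε) ^ k * cost c L' ≤ (1 - ε) ^ k * ((1 - ε) * cost c L) :=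
            mul_le_mul_of_nonneg_left hsub (pow_nonneg (by linarith) _)
        _ = (1 - ε) ^ (k + 1) * cost c L := by ring
        _ ≤ δ := hk

theorem within_randBatch (mode : SearchMode) (hc : ∀ u, 0 < c u) (hcB : ∀ u, c u ≤ B) (hB : 0 < B)
    {ε ρ δ : ℝ} (hε₀ : 0 < ε) (hε₁ : ε < 1) (hρ : 0 < ρ) {I : Finset N} {M k : ℕ}
    (hδ : ∀ u ∈ I, δ < c u) (hk : (1 - ε) ^ k * (Fintype.card N * B) ≤ δ) :
    Within f (fun _ => True) (1 + (M + k) * passRounds c B mode)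
      (Fintype.card N + 1 + (M + k) * passQueries c B mode)
      (randBatch mode c B ρ I M 1 le_rfl ε) := by
  refine Within.bind ((Within.ask _).mono (P' := fun F => F = mask _ f) (fun _ => id) le_rfl ?_)
    fun F hF => ?_
  · rw [length_gainQueries]
    exact Nat.succ_le_succ (Finset.card_le_univ _)
  · have hagree : GainsAgree F f I ∅ := by
      rw [hF]
      exact gainsAgree_mask fun S hS => hS
    rw [hagree.valuable_eq]
    refine within_randBatchLoop mode hc hε₀ hε₁ hρ (δ := δ)
      (fun u hu => hδ u (Finset.filter_subset _ _ hu)) ?_ (by omega)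
      (Finset.card_le_card (Finset.filter_subset _ _)) (by simpa [cost] using hB.le)
      (valuable_valuable _ _)
    refine (mul_le_mul_of_nonneg_left ?_ (pow_nonneg (by linarith) _)).trans hk
    calc cost c (valuable c B ρ f I ∅) ≤ cost c Finset.univ := cost_mono hc (Finset.subset_univ _)
      _ ≤ Fintype.card N * B := by
        simpa [cost] using Finset.sum_le_card_nsmul Finset.univ c B (fun u _ => hcB u)

/-! ### `Probe` -/

theorem within_augment (N₁ T A : Finset N) :
    Within f (fun _ => True) 1 (Fintype.card N + 2) (augment c B N₁ T A) := by
  refine Within.bind (r' := 0) (q' := 0)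
    ((Within.ask _).mono (P' := fun _ => True) (fun _ _ => trivial) le_rfl ?_) fun F _ => ?_
  · simp only [List.length_cons, List.length_map, Finset.length_toList]
    exact Nat.add_le_add_right (Finset.card_le_univ _) 2
  · split <;> exact .pure 0 0 trivial

theorem within_probe (mode : SearchMode) (hc : ∀ u, 0 < c u) (hcB : ∀ u, c u ≤ B) (hB : 0 < B)
    {ε ρ δ : ℝ} (hε₀ : 0 < ε) (hε₁ : ε < 1) (hρ : 0 < ρ) {N₁ N₂ : Finset N} {k R q : ℕ}
    {usm : Finset N → Alg N (Finset N)} (husm : ∀ X, Within f (fun _ => True) R q (usm X))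
    (hδ : ∀ u ∈ N₁, δ < c u) (hk : (1 - ε) ^ k * (Fintype.card N * B) ≤ δ) :
    Within f (fun _ => True) (2 * ((⌈(ε ^ 2)⁻¹⌉₊ + k) * passRounds c B mode) + R + 5)
      (2 * ((⌈(ε ^ 2)⁻¹⌉₊ + k) * passQueries c B mode) + q + 4 * Fintype.card N + 8)
      (probe mode usm c B ρ N₁ N₂ ε) := by
  refine Within.mono
    ((within_randBatch mode hc hcB hB hε₀ hε₁ hρ hδ hk).bind fun ⟨A₁, _, _⟩ _ =>
      (within_randBatch mode hc hcB hB hε₀ hε₁ hρ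
        (fun u hu => hδ u (Finset.sdiff_subset hu)) hk).bind fun ⟨A₂, _, _⟩ _ =>
      (within_augment N₁ ∅ A₁).bind fun T₁ _ => (within_augment N₁ T₁ A₂).bind
        (r' := R + 1) (q' := q + 2) fun T₂ _ => ?_) (fun _ => id) (by omega) (by omega)
  split_ifs
  · exact (husm _).bind fun A₃ _ => within_best [T₂, A₃]
  · exact .pure _ _ trivial

/-! ### `ParSKP` -/

theorem within_parSKP (mode : SearchMode) (hf : ∀ X, 0 ≤ f X) (hc : ∀ u, 0 < c u)
    (hcB : ∀ u, c u ≤ B) (hB : 0 < B) {ε α : ℝ} (hε₀ : 0 < ε) (hε₁ : ε < 1) (hα : 0 < α)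
    {k R q K : ℕ} {usm : Finset N → Alg N (Finset N)}
    (husm : ∀ X, Within f (fun _ => True) R q (usm X))
    (hk : (1 - ε) ^ k * (Fintype.card N * B) ≤ ε * (B / Fintype.card N))
    (hK : ∀ ρ : ℝ, 0 ≤ ρ → ∃ h : (exponents ε ρ (ρ * (Fintype.card N ^ 2 / ε))).Finite,
      h.toFinset.card ≤ K) :
    Within f (fun _ => True) (2 * ((⌈(ε ^ 2)⁻¹⌉₊ + k) * passRounds c B mode) + 2 * R + 8)
      (Fintype.card N + q + 3 + K * ⌈Real.logb (1 - ε) ε⌉₊ *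
        (2 * ((⌈(ε ^ 2)⁻¹⌉₊ + k) * passQueries c B mode) + q + 4 * Fintype.card N + 9))
      (parSKP mode usm α ε c B) := by
  set pr := 2 * ((⌈(ε ^ 2)⁻¹⌉₊ + k) * passRounds c B mode) + R + 5 with hpr
  set pq := 2 * ((⌈(ε ^ 2)⁻¹⌉₊ + k) * passQueries c B mode) + q + 4 * Fintype.card N + 8 with hpq
  set J := K * ⌈Real.logb (1 - ε) ε⌉₊ with hJ
  refine Within.mono (r := 1 + (R + (1 + (pr + 1))))
    (q := Fintype.card N + (q + (2 + (J * pq + (J + 1))))) ?_ (fun _ => id) (by omega)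
    (by rw [show J * (2 * ((⌈(ε ^ 2)⁻¹⌉₊ + k) * passQueries c B mode) + q + 4 * Fintype.card N + 9)
          = J * pq + J by rw [hpq]; ring]; omega)
  refine Within.bind ((Within.ask _).mono (P' := fun F => ∀ X, 0 ≤ F X) ?_ le_rfl (by simp))
    fun F hF => ?_
  · rintro F rfl X
    unfold mask
    split_ifs
    · exact hf X
    · exact le_rfl
  split
  · exact (husm _).mono (fun _ => id) (by omega) (by omega)
  rename_i w _
  refine (husm _).bind fun S₀ _ => (within_best [S₀, {w}]).bind fun S₁ _ => ?_
  have hmax : (Fintype.card N : ℝ) ^ 2 * α * F {w} / (ε * B)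
      = α * F {w} / B * (Fintype.card N ^ 2 / ε) := by
    field_simp
  obtain ⟨hfin, hcard⟩ := hK (α * F {w} / B) (div_nonneg (mul_nonneg hα.le (hF _)) hB.le)
  rw [← hmax] at hfin
  simp only [← hmax] at hcard
  rw [dif_pos hfin]
  have hlen : (hfin.toFinset.toList.flatMap (fun z => List.replicate ⌈Real.logb (1 - ε) ε⌉₊
      (probe mode usm c B ((1 - ε) ^ (-z))
        (Finset.univ.filter (fun u => ε * (B / (Fintype.card N : ℝ)) < c u))
        (Finset.univ \ Finset.univ.filter (fun u => ε * (B / (Fintype.card N : ℝ)) < c u))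
        ε))).length ≤ J := by
    simp only [List.length_flatMap, List.length_replicate, List.map_const', List.sum_replicate,
      Finset.length_toList, smul_eq_mul]
    exact Nat.mul_le_mul_right _ hcard
  refine ((Within.parAll (P := fun _ => True) (r := pr) (q := pq) ?_).mono
    (P' := fun Ts => Ts.length ≤ J) (fun Ts hTs => hTs.trans_le hlen) le_rfl
    (Nat.mul_le_mul_right _ hlen)).bind fun Ts hTs => (within_best _).mono (fun _ => id) le_rfl ?_
  · intro x hx
    obtain ⟨z, -, hz⟩ := List.mem_flatMap.1 hx
    obtain rfl := List.eq_of_mem_replicate hz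
    exact within_probe mode hc hcB hB hε₀ hε₁ (zpow_pos (by linarith) _) husm
      (fun u hu => (Finset.mem_filter.1 hu).2) hk
  · simpa using hTs

end ParSubmod

namespace ParSubmod

open Alg

/-! ### Numerical estimates -/

/-- On the logarithmic scale these are the integers in an interval of length `log x / -log (1 - ε)`.
For `ρ = 0` the interval is `{0}`, which contains no power. -/
theorem exponents_finite_card_le {ε x ρ : ℝ} (hε₀ : 0 < ε) (hε₁ : ε < 1) (hx : 0 < x)
    (hρ : 0 ≤ ρ) : ∃ h : (exponents ε ρ (ρ * x)).Finite,
      h.toFinset.card ≤ ⌈Real.log x / -Real.log (1 - ε)⌉₊ + 1 := by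
  have h1 : 0 < 1 - ε := by linarith
  have hl : 0 < -Real.log (1 - ε) := by linarith [Real.log_neg h1 (by linarith)]
  set l := -Real.log (1 - ε) with hldef
  rcases hρ.eq_or_lt with rfl | hρ
  · have : exponents ε 0 (0 * x) = ∅ := by
      refine Set.eq_empty_iff_forall_notMem.2 fun z hz => ?_
      have := hz.2
      rw [zero_mul] at this
      exact (zpow_pos h1 _).not_ge this
    rw [this]
    exact ⟨Set.finite_empty, by simp⟩
  · have hsub : exponents ε ρ (ρ * x) ⊆
        (Finset.Icc ⌈Real.log ρ / l⌉ ⌊(Real.log ρ + Real.log x) / l⌋ : Finset ℤ) := by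
      rintro z ⟨hz₁, hz₂⟩
      have hlog : Real.log ((1 - ε) ^ (-z)) = z * l := by
        rw [Real.log_zpow, hldef]; push_cast; ring
      have hz₁' := Real.log_le_log hρ hz₁
      have hz₂' := Real.log_le_log (zpow_pos h1 _) hz₂
      rw [hlog] at hz₁' hz₂'
      rw [Real.log_mul hρ.ne' hx.ne'] at hz₂'
      rw [Finset.coe_Icc, Set.mem_Icc, Int.ceil_le, Int.le_floor, div_le_iff₀ hl, le_div_iff₀ hl]
      exact ⟨hz₁', hz₂'⟩
    have hfin := (Finset.finite_toSet _).subset hsub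
    refine ⟨hfin, (Finset.card_le_card (Set.Finite.toFinset_subset.2 hsub)).trans ?_⟩
    rw [Int.card_Icc, Int.toNat_le]
    have ha := Int.le_ceil (Real.log ρ / l)
    have hb := Int.floor_le ((Real.log ρ + Real.log x) / l)
    have hd := Nat.le_ceil (Real.log x / l)
    rw [add_div] at hb
    have : ((⌊(Real.log ρ + Real.log x) / l⌋ - ⌈Real.log ρ / l⌉ : ℤ) : ℝ) ≤
        ((⌈Real.log x / l⌉₊ : ℤ) : ℝ) := by
      push_cast
      rw [add_div]
      linarith
    have := Int.cast_le.1 this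
    push_cast
    linarith

theorem pow_ceil_log_div_le {ε x : ℝ} (hε₀ : 0 < ε) (hε₁ : ε < 1) (hx : 0 < x) :
    (1 - ε) ^ ⌈Real.log x / -Real.log (1 - ε)⌉₊ ≤ x⁻¹ := by
  have h1 : 0 < 1 - ε := by linarith
  have hl : 0 < -Real.log (1 - ε) := by linarith [Real.log_neg h1 (by linarith)]
  rw [← Real.log_le_log_iff (pow_pos h1 _) (inv_pos.2 hx), Real.log_pow, Real.log_inv]
  have := (div_le_iff₀ hl).1 (Nat.le_ceil (Real.log x / -Real.log (1 - ε)))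
  linarith

theorem natLog_two_le (r : ℕ) (hr : r ≠ 0) : (Nat.log 2 r : ℝ) ≤ 2 * Real.log r := by
  have h : ((2 ^ Nat.log 2 r : ℕ) : ℝ) ≤ r := by exact_mod_cast Nat.pow_log_le_self 2 hr
  have := Real.log_le_log (by positivity) h
  rw [Nat.cast_pow, Real.log_pow, Nat.cast_ofNat] at this
  have h2 := Real.log_two_gt_d9
  nlinarith [(Nat.cast_nonneg (Nat.log 2 r) : (0 : ℝ) ≤ _)]

theorem half_le_log {n : ℕ} (hn : 2 ≤ n) : 1 / 2 ≤ Real.log n := by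
  have h : Real.log 2 ≤ Real.log n := Real.log_le_log (by norm_num) (by exact_mod_cast hn)
  linarith [Real.log_two_gt_d9]

/-- Here `l` is `log n` and `x` is `1` or `log r`; additive constants are absorbed through `l * x ≥
1/4`. -/
theorem rounds_estimate {D R m p l x : ℝ} (hR : 0 ≤ R) (hm₀ : 0 ≤ m) (hm : m ≤ D * l)
    (hp : p ≤ 12 * x) (hl : 1 / 2 ≤ l) (hx : 1 / 2 ≤ x) :
    2 * (m * p) + 2 * R + 8 ≤ (24 * D + 4 * (2 * R + 8)) * (l * x) := by
  have h1 : m * p ≤ D * l * (12 * x) :=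
    (mul_le_mul_of_nonneg_left hp hm₀).trans (mul_le_mul_of_nonneg_right hm (by linarith))
  have h2 : 1 / 4 ≤ l * x := by nlinarith
  nlinarith [mul_le_mul_of_nonneg_left h2 (by linarith : 0 ≤ 4 * (2 * R + 8))]

/-- The two factors `l = log n` come from the number `K` of thresholds and the number `m` of passes;
`y` is `r` or `log r`, according to the search. -/
theorem queries_estimate {D J Q K m p l n y : ℝ} (hD : 0 ≤ D) (hJ : 0 ≤ J) (hQ : 0 ≤ Q)
    (hm₀ : 0 ≤ m) (hm : m ≤ D * l) (hp₀ : 0 ≤ p) (hK : K ≤ D * l)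
    (hp : p ≤ 24 * (n * y)) (hl : 1 / 2 ≤ l) (hn : 2 ≤ n) (hy : 1 / 2 ≤ y) :
    n + Q * n + 3 + K * J * (2 * (m * p) + Q * n + 4 * n + 9) ≤
      (8 * (Q + 3) + D * J * (48 * D + 4 * (Q + 9))) * (n * y * l ^ 2) := by
  have h1 : m * p ≤ D * l * (24 * (n * y)) :=
    (mul_le_mul_of_nonneg_left hp hm₀).trans (mul_le_mul_of_nonneg_right hm (by positivity))
  have hly : 1 ≤ 4 * (l * y) := by nlinarith
  have hlly : 1 ≤ 8 * (l * y) * l := by nlinarith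
  have h2 : (Q + 9) * n ≤ 4 * (Q + 9) * (n * y * l) := by
    nlinarith [mul_le_mul_of_nonneg_left hly (by positivity : 0 ≤ (Q + 9) * n)]
  have h3 : (Q + 3) * n ≤ 8 * (Q + 3) * (n * y * l ^ 2) := by
    nlinarith [mul_le_mul_of_nonneg_left hlly (by positivity : 0 ≤ (Q + 3) * n)]
  have h4 : 2 * (m * p) + Q * n + 4 * n + 9 ≤ (48 * D + 4 * (Q + 9)) * (n * y * l) := by
    linarith
  have h5 : K * J * (2 * (m * p) + Q * n + 4 * n + 9) ≤
      D * l * J * ((48 * D + 4 * (Q + 9)) * (n * y * l)) :=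
    (mul_le_mul_of_nonneg_right (mul_le_mul_of_nonneg_right hK hJ) (by positivity)).trans
      (mul_le_mul_of_nonneg_left h4 (by positivity))
  calc _ ≤ (Q + 3) * n + D * l * J * ((48 * D + 4 * (Q + 9)) * (n * y * l)) := by linarith
    _ ≤ 8 * (Q + 3) * (n * y * l ^ 2) + D * l * J * ((48 * D + 4 * (Q + 9)) * (n * y * l)) := by
      gcongr
    _ = _ := by ring

theorem coe_le_ofReal_of_le {a : ℕ∞} {m : ℕ} {x : ℝ} (ha : a ≤ m) (hm : (m : ℝ) ≤ x) :
    (a : ℝ≥0∞) ≤ ENNReal.ofReal x := by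
  calc (a : ℝ≥0∞) ≤ ((m : ℕ∞) : ℝ≥0∞) := by exact_mod_cast ha
    _ = ENNReal.ofReal m := by simp
    _ ≤ ENNReal.ofReal x := ENNReal.ofReal_le_ofReal hm

/-! ### The complexity of `ParSKP` -/

/-- The logarithmic bound on the number of thresholds and of passes of `RandBatch`. -/
theorem exists_passes_le_mul_log {ε : ℝ} (hε₀ : 0 < ε) (hε₁ : ε < 1) (M : ℕ) :
    ∃ D : ℝ, 0 < D ∧ ∀ n : ℕ, 2 ≤ n →
      (M : ℝ) + (⌈Real.log ((n : ℝ) ^ 2 / ε) / -Real.log (1 - ε)⌉₊ + 1 : ℕ) ≤ D * Real.log n := by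
  have hl : 0 < -Real.log (1 - ε) := by
    linarith [Real.log_neg (by linarith : 0 < 1 - ε) (by linarith)]
  set l := -Real.log (1 - ε)
  have hle : Real.log ε < 0 := Real.log_neg hε₀ hε₁
  -- Since `log n ≥ 1/2`, the term `-log ε` costs at most `-2 log ε · log n`, and `M + 2` (rounding
  -- up and the extra `1`) at most `(2M + 4) log n`.
  refine ⟨(2 - 2 * Real.log ε) / l + 2 * M + 4, by
    have : 0 < (2 - 2 * Real.log ε) / l := div_pos (by linarith) hl
    positivity, fun n hn => ?_⟩
  have hn' : (2 : ℝ) ≤ n := by exact_mod_cast hn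
  have hln := half_le_log hn
  have hx : Real.log ((n : ℝ) ^ 2 / ε) = 2 * Real.log n - Real.log ε := by
    rw [Real.log_div (by positivity) hε₀.ne', Real.log_pow]; norm_num
  have hx' : Real.log ((n : ℝ) ^ 2 / ε) ≤ (2 - 2 * Real.log ε) * Real.log n := by
    rw [hx]; nlinarith
  have hceil := (Nat.ceil_lt_add_one (a := Real.log ((n : ℝ) ^ 2 / ε) / l)
    (div_nonneg (by rw [hx]; linarith) hl.le)).le
  have hdiv : Real.log ((n : ℝ) ^ 2 / ε) / l ≤ (2 - 2 * Real.log ε) / l * Real.log n := by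
    rw [div_mul_eq_mul_div]
    gcongr
  push_cast
  nlinarith [(Nat.cast_nonneg M : (0 : ℝ) ≤ M)]

theorem passRounds_le {N : Type} [Fintype N] (c : N → ℝ) (B : ℝ) :
    (passRounds c B .exhaustive : ℝ) ≤ 12 * 1 ∧
      (2 ≤ maxCard c B → (passRounds c B .binary : ℝ) ≤ 12 * Real.log (maxCard c B)) := by
  refine ⟨by norm_num [passRounds, searchRounds], fun hr => ?_⟩
  have h₁ := natLog_two_le (maxCard c B) (by omega)
  have h₂ := half_le_log hr
  simp only [passRounds, searchRounds]
  push_cast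
  linarith

theorem passQueries_le {N : Type} [Fintype N] (c : N → ℝ) (B : ℝ) (hn : 2 ≤ Fintype.card N) :
    (1 ≤ maxCard c B → (passQueries c B .exhaustive : ℝ) ≤
        24 * (Fintype.card N * maxCard c B)) ∧
      (2 ≤ maxCard c B → (passQueries c B .binary : ℝ) ≤
        24 * (Fintype.card N * Real.log (maxCard c B))) := by
  have hn' : (2 : ℝ) ≤ Fintype.card N := by exact_mod_cast hn
  refine ⟨fun hr => ?_, fun hr => ?_⟩
  · have hr' : (1 : ℝ) ≤ maxCard c B := by exact_mod_cast hr
    simp only [passQueries, searchQueries]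
    push_cast
    nlinarith
  · have h₁ := natLog_two_le (maxCard c B) (by omega)
    have h₂ := half_le_log hr
    simp only [passQueries, searchQueries]
    push_cast
    calc ((Fintype.card N : ℝ) + 1 + 2 * ((Nat.log 2 (maxCard c B) + 1) * (Fintype.card N + 1)) +
          (Fintype.card N + 1)) = (Fintype.card N + 1) * (2 * Nat.log 2 (maxCard c B) + 4) := by ring
      _ ≤ (2 * Fintype.card N) * (12 * Real.log (maxCard c B)) :=
        mul_le_mul (by linarith) (by linarith) (by positivity) (by positivity)
      _ = _ := by ring

end ParSubmod

/-! ### Assembly of the four bounds. -/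

theorem mainTheorem2 (ε : ℝ) (hε₀ : 0 < ε) (hε₁ : ε < 1) (R Q : ℕ) :
    ∃ C : ℝ, 0 < C ∧
      ∀ (N : Type) [Fintype N] [DecidableEq N] (f : Finset N → ℝ) (c : N → ℝ) (B α : ℝ)
        (usm : Finset N → ParSubmod.Alg N (Finset N)),
        2 ≤ Fintype.card N →
        ParSubmod.IsSubmodular f → (∀ X, 0 ≤ f X) →
        0 < B → (∀ u, 0 < c u) → (∀ u, c u ≤ B) → 0 < α →
        (∀ X, (usm X).rounds f ≤ R ∧ (usm X).queries f ≤ (Q * Fintype.card N : ℕ)) →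
        (((ParSubmod.parSKP .exhaustive usm α ε c B).rounds f : ℝ≥0∞) ≤
            ENNReal.ofReal (C * Real.log (Fintype.card N)) ∧
          ((ParSubmod.parSKP .exhaustive usm α ε c B).queries f : ℝ≥0∞) ≤
            ENNReal.ofReal (C * (Fintype.card N * ParSubmod.maxCard c B *
              Real.log (Fintype.card N) ^ 2))) ∧
        (2 ≤ ParSubmod.maxCard c B →
          ((ParSubmod.parSKP .binary usm α ε c B).rounds f : ℝ≥0∞) ≤
            ENNReal.ofReal (C * (Real.log (Fintype.card N) *
              Real.log (ParSubmod.maxCard c B))) ∧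
          ((ParSubmod.parSKP .binary usm α ε c B).queries f : ℝ≥0∞) ≤
            ENNReal.ofReal (C * (Fintype.card N * Real.log (Fintype.card N) ^ 2 *
              Real.log (ParSubmod.maxCard c B)))) := by
  obtain ⟨D, hD, hDlog⟩ := ParSubmod.exists_passes_le_mul_log hε₀ hε₁ ⌈(ε ^ 2)⁻¹⌉₊
  set J := ⌈Real.logb (1 - ε) ε⌉₊ with hJ
  set C₁ : ℝ := 24 * D + 4 * (2 * R + 8) with hC₁
  set C₂ : ℝ := 8 * (Q + 3) + D * J * (48 * D + 4 * (Q + 9)) with hC₂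
  have hC₁pos : 0 < C₁ := by positivity
  have hC₂pos : 0 < C₂ := by positivity
  refine ⟨C₁ + C₂, by positivity, ?_⟩
  intro N _ _ f c B α usm hn _ hf hB hc hcB hα husm
  have hn' : (2 : ℝ) ≤ Fintype.card N := by exact_mod_cast hn
  have : Nonempty N := Fintype.card_pos_iff.1 (by omega)
  have hx : (0 : ℝ) < (Fintype.card N : ℝ) ^ 2 / ε := by positivity
  have hlog := ParSubmod.half_le_log hn
  have hDn := hDlog _ hn
  -- One `k` serves twice, because `n²/ε` is both the ratio of `nB` to `εB/n` and the ratio of the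
  -- endpoints of the threshold interval.
  set k := ⌈Real.log ((Fintype.card N : ℝ) ^ 2 / ε) / -Real.log (1 - ε)⌉₊ with hk
  push_cast at hDn
  have hr : 1 ≤ ParSubmod.maxCard c B := by
    obtain ⟨u⟩ := this
    simpa using ParSubmod.card_le_maxCard (X := {u}) (by simpa [ParSubmod.cost] using hcB u)
  have hpow : (1 - ε) ^ k * (Fintype.card N * B) ≤ ε * (B / Fintype.card N) := by
    calc (1 - ε) ^ k * (Fintype.card N * B)
        ≤ ((Fintype.card N : ℝ) ^ 2 / ε)⁻¹ * (Fintype.card N * B) :=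
          mul_le_mul_of_nonneg_right (ParSubmod.pow_ceil_log_div_le hε₀ hε₁ hx) (by positivity)
      _ = ε * (B / Fintype.card N) := by field_simp
  have hW := fun mode => ParSubmod.within_parSKP mode hf hc hcB hB hε₀ hε₁ hα
    (fun X => ParSubmod.Alg.within_of_le (husm X).1 (husm X).2) hpow
    (fun ρ hρ => ParSubmod.exponents_finite_card_le hε₀ hε₁ hx hρ)
  rw [← hk] at hW
  have hrounds : ∀ mode {x : ℝ}, (ParSubmod.passRounds c B mode : ℝ) ≤ 12 * x → 1 / 2 ≤ x →
      ((ParSubmod.parSKP mode usm α ε c B).rounds f : ℝ≥0∞) ≤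
        ENNReal.ofReal ((C₁ + C₂) * (Real.log (Fintype.card N) * x)) := by
    intro mode x hp hx
    refine ParSubmod.coe_le_ofReal_of_le (hW mode).rounds_le ?_
    have h := ParSubmod.rounds_estimate (D := D) (R := R) (m := ⌈(ε ^ 2)⁻¹⌉₊ + k)
      (Nat.cast_nonneg _) (by positivity) (by linarith) hp hlog hx
    push_cast
    refine h.trans (mul_le_mul_of_nonneg_right (by linarith) ?_)
    exact mul_nonneg (by linarith) (by linarith)
  have hqueries : ∀ mode {y : ℝ},
      (ParSubmod.passQueries c B mode : ℝ) ≤ 24 * (Fintype.card N * y) → 1 / 2 ≤ y →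
      ((ParSubmod.parSKP mode usm α ε c B).queries f : ℝ≥0∞) ≤
        ENNReal.ofReal ((C₁ + C₂) * (Fintype.card N * y * Real.log (Fintype.card N) ^ 2)) := by
    intro mode y hp hy
    refine ParSubmod.coe_le_ofReal_of_le (hW mode).queries_le ?_
    have h := ParSubmod.queries_estimate (D := D) (J := J) (Q := Q) (K := k + 1)
      (m := ⌈(ε ^ 2)⁻¹⌉₊ + k) hD.le (Nat.cast_nonneg _) (Nat.cast_nonneg _) (by positivity)
      (by linarith) (Nat.cast_nonneg _) (by linarith [(Nat.cast_nonneg ⌈(ε ^ 2)⁻¹⌉₊ : (0 : ℝ) ≤ _)])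
      hp hlog hn' hy
    push_cast
    refine h.trans (mul_le_mul_of_nonneg_right (by linarith) ?_)
    exact mul_nonneg (mul_nonneg (by linarith) (by linarith)) (sq_nonneg _)
  have hpr := ParSubmod.passRounds_le c B
  have hpq := ParSubmod.passQueries_le c B hn
  refine ⟨⟨?_, ?_⟩, fun hr₂ => ⟨?_, ?_⟩⟩
  · simpa using hrounds .exhaustive hpr.1 (by norm_num)
  · refine hqueries .exhaustive (hpq.1 hr) ?_
    have : (1 : ℝ) ≤ ParSubmod.maxCard c B := by exact_mod_cast hr
    linarith
  · exact hrounds .binary (hpr.2 hr₂) (ParSubmod.half_le_log hr₂)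
  · rw [mul_right_comm]
    exact hqueries .binary (hpq.2 hr₂) (ParSubmod.half_le_log hr₂)
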